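/- **Setting.** Let $\mathcal X,\mathcal A$ be finite sets, $\mathcal D$ a probability distribution on $\mathcal X$, $\pi_0:\mathcal X\to\Delta(\mathcal A)$ a base policy, $\gamma>0$, $R>0$, and $\mathcal F$ a class of functions $f:\mathcal X\times\mathcal A\to\mathbb R$ with $\|f\|_\infty\le R$. Put $\pi_f(a\mid x)\propto\pi_0(a\mid x)e^{f(x,a)}$, $\Pi_{\mathcal F}=\{\pi_f: f\in\mathcal F\}$, and assume $\pi_0\in\Pi_{\mathcal F}$. Let $r^*$ be the true reward and $\pi^*(a\mid x)\propto\pi_0(a\mid x)\exp(\gamma^{-1}r^*(x,a))$ the target policy. Assume $\pi^*=\pi_{f^*}$ for some $f^*\in\mathcal F$, and let $\tilde r$ be a reward model with $\gamma^{-1}\tilde r\in\mathcal F$. Let $\Delta\mathcal F$ be the class of functions $\Delta f(x,a^1,a^2)=f(x,a^1)-f(x,a^2)$, $f\in\mathcal F$. Its pseudodimension $\mathrm{Pdim}(\Delta\mathcal F)$ is the largest $m$ for which there are distinct points $z_1,\dots,z_m$ and reals $t_1,\dots,t_m$ such that every sign pattern in $\{-1,1\}^m$ equals $(\mathrm{sgn}(h(z_i)-t_i))_i$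 for some $h\in\Delta\mathcal F$. Let $$\mathrm{MAD}_\pi(f)=\mathbb E_{x\sim\mathcal D,\,a\sim\pi(x)}\bigl|f(x,a)-\mathbb E_{b\sim\pi(x)}f(x,b)\bigr|,$$ $$C_{\pi\to\pi'}=\inf\{C>0:\mathrm{MAD}_{\pi'}(f)\le C\,\mathrm{MAD}_\pi(f)\ \ \forall f\in\mathcal F-\mathcal F\},$$ $$C_{\mathcal F}(r)=\sup\{C_{\pi_f\to\pi^*}: f\in\mathcal F,\ \mathrm{MAD}_{\pi^*}(f-f^*)\le r\}.$$ Assume that $\bar C_{\mathcal F}$ is a convex function on $[0,R]$ with $C_{\mathcal F}\le\bar C_{\mathcal F}$ on $[0,R]$ and $\bar C_{\mathcal F}(0)\le B$. **Algorithm.** Let $\ell:\mathbb R^2\to\mathbb R_{\ge0}$ satisfy $\ell(y,z)=0$ iff $y=z$, and for a dataset $D$ of triples $(x,a^1,a^2)$ let $$\mathcal L(\pi;\pi',r,D)=\sum_{(x,a^1,a^2)\in D}\ell\Bigl(\gamma\ln\tfrac{\pi(a^1\mid x)}{\pi(a^2\mid x)}-\gamma\ln\tfrac{\pi'(a^1\mid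 x)}{\pi'(a^2\mid x)},\ r(x,a^1)-r(x,a^2)\Bigr).$$ On-policy reward distillation starts from $\hat f_0=0$, $\hat\pi_0=\pi_0$. In round $k=0,\dots,K-1$ it draws, conditionally on the past, $n$ i.i.d. triples $x\sim\mathcal D$, $a^1,a^2\sim\hat\pi_k(x)$ (independent given $x$), which form $D_k$, and picks $\hat f_{k+1}\in\mathcal F$ such that $\hat\pi_{k+1}=\pi_{\hat f_{k+1}}$ minimizes over $\pi\in\Pi_{\mathcal F}$ either $\mathcal L(\pi;\pi_0,\tilde r,D_k)$ (fixed regularization) or $\mathcal L(\pi;\hat\pi_k,\tilde r-\gamma\ln(\hat\pi_k/\pi_0),D_k)$ (reward calibration, with calibration level $\gamma$). The minimizer may be any one; the same update scheme is used in all rounds. **Theorem (Fast convergence of on-policy reward distillation).** For every $B$ there are constants $c,C>0$ depending only on $B$ such that the following holds in every setting as above. Let $\eta,\delta\in(0,1)$, $K\in\mathbb N$, $\varepsilon_{\mathrm{RM}}=\mathrm{MAD}_{\pi^*}(\gamma^{-1}\tilde r-f^*)$ and $$\xi_n=\frac{R\,\mathrm{Pdim}(\Delta\mathcal F)}{\eta\,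 n}\ln\frac{Kn}{\delta}.$$ Let $N\subseteq\mathbb N$ be any set of batch sizes and, for each $n\in N$, consider a run of $K$ rounds with batch size $n$, all these runs being defined on one probability space with an arbitrary joint distribution. Then with probability at least $1-\delta$, simultaneously for all $n\in N$ with $Kn\ge2$ and $\xi_n\,\bar C_{\mathcal F}(R)\le c\,R$, the output $\hat f_K$ of the run with batch size $n$ satisfies $$\mathrm{MAD}_{\pi^*}(\hat f_K-f^*)\le C\,\bigl(\xi_n\vee R\eta^K\vee\varepsilon_{\mathrm{RM}}\bigr).$$ -/

import Mathlib

open MeasureTheory ProbabilityTheory Finset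
open scoped NNReal ENNReal BigOperators

namespace RewardDistillation

noncomputable section

/-- `π x a` is the probability `π(a ∣ x)` of the response `a` to the prompt `x`. -/
def IsPolicy {X A : Type*} [Fintype A] (π : X → A → ℝ) : Prop :=
  ∀ x, π x ∈ stdSimplex ℝ A

/-- The policy `π_f(a ∣ x) ∝ π₀(a ∣ x) exp f(x, a)`. -/
def tilt {X A : Type*} [Fintype A] (π₀ f : X → A → ℝ) : X → A → ℝ :=
  fun x a => π₀ x a * Real.exp (f x a) / ∑ b, π₀ x b * Real.exp (f x b)

/-- The policy class `Π_F = {π_f : f ∈ F}`. -/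
def policyClass {X A : Type*} [Fintype A] (π₀ : X → A → ℝ) (F : Set (X → A → ℝ)) :
    Set (X → A → ℝ) :=
  {π | ∃ f ∈ F, π = tilt π₀ f}

/-- The mean absolute deviation
`MAD_π(f) = E_{x ∼ D, a ∼ π(x)} |f(x, a) - E_{b ∼ π(x)} f(x, b)|`. -/
def MAD {X A : Type*} [Fintype X] [Fintype A] (D : X → ℝ) (π f : X → A → ℝ) : ℝ :=
  ∑ x, D x * ∑ a, π x a * |f x a - ∑ b, π x b * f x b|

/-- The coverage `C_{π → π'} = inf {C > 0 : MAD_{π'}(f) ≤ C MAD_π(f) for all f ∈ F - F}`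
of `π'` by `π`, with value `+∞` if there is no such `C`. -/
def coverage {X A : Type*} [Fintype X] [Fintype A] (D : X → ℝ) (F : Set (X → A → ℝ))
    (π π' : X → A → ℝ) : EReal :=
  ⨅ (C : ℝ) (_ : 0 < C ∧ ∀ f ∈ F, ∀ g ∈ F, MAD D π' (f - g) ≤ C * MAD D π (f - g)), (C : EReal)

/-- The local coverage
`C_F(r) = sup {C_{π_f → π⋆} : f ∈ F, MAD_{π⋆}(f - f⋆) ≤ r}`, where `π⋆ = π_{f⋆}`. -/
def localCoverage {X A : Type*} [Fintype X] [Fintype A] (D : X → ℝ) (π₀ : X → A → ℝ)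
    (F : Set (X → A → ℝ)) (fstar : X → A → ℝ) (r : ℝ) : EReal :=
  ⨆ (f : X → A → ℝ) (_ : f ∈ F ∧ MAD D (tilt π₀ fstar) (f - fstar) ≤ r),
    coverage D F (tilt π₀ f) (tilt π₀ fstar)

/-- The class `ΔF` of the pairwise differences `Δf(x, a¹, a²) = f(x, a¹) - f(x, a²)`, `f ∈ F`. -/
def deltaClass {X A : Type*} (F : Set (X → A → ℝ)) : Set (X × A × A → ℝ) :=
  {h | ∃ f ∈ F, h = fun z => f z.1 z.2.1 - f z.1 z.2.2}

/-- `S` is pseudo-shattered by `H`: for some witness `t`, every sign pattern on `S` (`T` is the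
set of points with sign `+1`) is the pattern of signs of `h - t` for some `h ∈ H`. -/
def PseudoShatters {Z : Type*} (H : Set (Z → ℝ)) (S : Finset Z) : Prop :=
  ∃ t : Z → ℝ, ∀ T ⊆ S, ∃ h ∈ H, ∀ z ∈ S, (z ∈ T → t z < h z) ∧ (z ∉ T → h z < t z)

/-- The pseudodimension: the largest cardinality of a pseudo-shattered set. -/
def pdim {Z : Type*} (H : Set (Z → ℝ)) : ℕ∞ :=
  ⨆ (S : Finset Z) (_ : PseudoShatters H S), (S.card : ℕ∞)

/-- On a finite domain the pseudodimension is finite. -/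
theorem pdim_ne_top {Z : Type*} [Fintype Z] (H : Set (Z → ℝ)) : pdim H ≠ ⊤ := by
  have h : pdim H ≤ (Fintype.card Z : ℕ∞) :=
    iSup₂_le fun S _ => by exact_mod_cast Finset.card_le_univ S
  exact ne_top_of_le_ne_top (ENat.natCast_ne_top _) h

/-- The rate `ξ_n = R · Pdim(ΔF) / (η n) · ln (K n / δ)`. -/
def rate {X A : Type*} (F : Set (X → A → ℝ)) (R η δ : ℝ) (K n : ℕ) : ℝ :=
  R * ((pdim (deltaClass F)).toNat : ℝ) / (η * n) * Real.log (K * n / δ)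

/-- The probability, when `x_i ∼ D` and `a_i¹, a_i² ∼ π(x_i)` are drawn independently for
`i = 1, …, n`, of the dataset `d = ((x_i, a_i¹, a_i²))_i`. -/
def dataProb {X A : Type*} (D : X → ℝ) (π : X → A → ℝ) {n : ℕ} (d : Fin n → X × A × A) : ℝ :=
  ∏ i, D (d i).1 * π (d i).1 (d i).2.1 * π (d i).1 (d i).2.2

/-- The reward distillation objective `L_RD(π; π', r, d)`. -/
def rdLoss {X A : Type*} (l : ℝ → ℝ → ℝ≥0) (γ : ℝ) (π π' r : X → A → ℝ) {n : ℕ}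
    (d : Fin n → X × A × A) : ℝ≥0 :=
  ∑ i, l (γ * Real.log (π (d i).1 (d i).2.1 / π (d i).1 (d i).2.2)
          - γ * Real.log (π' (d i).1 (d i).2.1 / π' (d i).1 (d i).2.2))
        (r (d i).1 (d i).2.1 - r (d i).1 (d i).2.2)

/-- The two update schemes; reward calibration carries its calibration level `γ_c`. -/
inductive Scheme where
  | fixedRegularization : Scheme
  | rewardCalibration (γc : ℝ) : Scheme

/-- The objective minimised over `π` in one round, where `πk` is the current policy. -/
def roundLoss {X A : Type*} (l : ℝ → ℝ → ℝ≥0) (γ : ℝ) (π₀ rtilde πk : X → A → ℝ) {n : ℕ}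
    (d : Fin n → X × A × A) (π : X → A → ℝ) : Scheme → ℝ≥0
  | .fixedRegularization => rdLoss l γ π π₀ rtilde d
  | .rewardCalibration γc =>
      rdLoss l γ π πk (fun x a => rtilde x a - γc * Real.log (πk x a / π₀ x a)) d

/-- A run of `K` rounds of on-policy reward distillation with batch size `n`, on the probability
space `(Ω, μ)`. The policy after `k` rounds is `π_{fhat k}`, and `𝒢 k` is the information
available when round `k` starts (all earlier datasets and policies, and possibly random
tie-breaking). -/
structure IsRun {X A Ω : Type*} [Fintype X] [Fintype A] {mΩ : MeasurableSpace Ω} (μ : Measure Ω)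
    (D : X → ℝ) (π₀ : X → A → ℝ) (F : Set (X → A → ℝ)) (rtilde : X → A → ℝ) (γ : ℝ)
    (l : ℝ → ℝ → ℝ≥0) (scheme : Scheme) (K n : ℕ) (𝒢 : Filtration ℕ mΩ)
    (data : ℕ → Ω → Fin n → X × A × A) (fhat : ℕ → Ω → X → A → ℝ) : Prop where
  /-- The run starts from `π₀`. -/
  init : ∀ ω, fhat 0 ω = 0
  measurable_fhat : ∀ k ≤ K, Measurable[𝒢 k] (fhat k)
  measurable_data : ∀ k < K, ∀ d, MeasurableSet[𝒢 (k + 1)] {ω | data k ω = d}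
  /-- Given the past, round `k` draws `n` independent samples `x ∼ D`, `a¹, a² ∼ π_{fhat k}(x)`. -/
  on_policy : ∀ k < K, ∀ d,
    μ[({ω | data k ω = d}).indicator (fun _ => (1 : ℝ)) | 𝒢 k]
      =ᵐ[μ] fun ω => dataProb D (tilt π₀ (fhat k ω)) d
  mem_class : ∀ k < K, ∀ᵐ ω ∂μ, fhat (k + 1) ω ∈ F
  /-- The new policy minimises the objective of the round over `Π_F`. -/
  update : ∀ k < K, ∀ᵐ ω ∂μ,
    IsMinOn (fun π => roundLoss l γ π₀ rtilde (tilt π₀ (fhat k ω)) (data k ω) π scheme)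
      (policyClass π₀ F) (tilt π₀ (fhat (k + 1) ω))

end

end RewardDistillation

namespace RewardDistillation

/-! ### The realizable Vapnik–Chervonenkis bound -/

/-! The labels are noise-free. Since `γ⁻¹ • rtilde ∈ F`, the minimal loss of a round is zero, and
every minimizer reproduces the pairwise differences of `γ⁻¹ • rtilde` on the whole batch. Learning
is therefore realizable, with error of order 1/n rather than 1/√n.

Carriers of the fast rate: the sets where a difference function lies strictly above (or below) the
target have VC dimension at most the pseudodimension (`card_le_pdim_of_shatters_upperFamily` and its
twin), and with high probability a sample meets every such set of probability over ε ~ d log(Kn/δ)/n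
(`missing_probability_le`). An interpolating function then disagrees with the target on probability
at most 2ε, so its MAD under the sampling policy is at most 112ηξ (`IsRun.ae_MAD_le`).

Coverage transfers this bound to the target policy. With r the current error, convexity gives C̄(r)
≤ M + (r/R) C̄(R), and ξ C̄(R) ≤ R/224 turns one round into r' ≤ (η/2) r + 112Mξ + ε_RM
(`le_of_error_recursion`, `MAD_final_le`). Iteration gives the claim.

Failure probabilities δ/(Kn(n+1)) per round sum to at most δ over all rounds and batch sizes, so the
joint law of the runs plays no role. -/

theorem sum_range_choose_le_pow (m d : ℕ) :
    ∑ i ∈ range (d + 1), m.choose i ≤ (m + 1) ^ d := by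
  rw [add_pow]
  refine sum_le_sum fun i hi => ?_
  have h : 0 < d.choose i := Nat.choose_pos (Nat.lt_succ_iff.1 (mem_range.1 hi))
  calc m.choose i ≤ m ^ i := Nat.choose_le_pow m i
    _ ≤ m ^ i * 1 ^ (d - i) * d.choose i := by
      rw [one_pow, mul_one]; exact Nat.le_mul_of_pos_right _ h

/-- Sauer–Shelah: the number of traces on `U`. -/
theorem card_trace_le {Z : Type*} [DecidableEq Z] (𝒮 : Finset (Finset Z)) (U : Finset Z) (d : ℕ)
    (h : ∀ s, 𝒮.Shatters s → s.card ≤ d) :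
    (𝒮.image (· ∩ U)).card ≤ (U.card + 1) ^ d := by
  refine le_trans (card_le_card_shatterer _) (le_trans ?_ (sum_range_choose_le_pow U.card d))
  -- A set shattered by the traces lies in `U` and is already shattered by `𝒮`, so it has at most
  -- `d` elements.
  have hsub : (𝒮.image (· ∩ U)).shatterer ⊆
      (range (d + 1)).biUnion fun i => powersetCard i U := by
    intro s hs
    rw [mem_shatterer] at hs
    have hsU : s ⊆ U := by
      obtain ⟨u, hu, hsu⟩ := hs (Subset.refl s)
      obtain ⟨v, -, rfl⟩ := mem_image.1 hu
      rw [← hsu]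
      exact inter_subset_right.trans inter_subset_right
    have hsh : 𝒮.Shatters s := by
      intro t ht
      obtain ⟨u, hu, hsu⟩ := hs ht
      obtain ⟨v, hv, rfl⟩ := mem_image.1 hu
      refine ⟨v, hv, ?_⟩
      rw [← hsu]
      ext z
      simp only [mem_inter]
      exact ⟨fun hz => ⟨hz.1, hz.2, hsU hz.1⟩, fun hz => ⟨hz.1, hz.2.1⟩⟩
    exact mem_biUnion.2 ⟨s.card, mem_range.2 (Nat.lt_succ_of_le (h s hsh)),
      mem_powersetCard.2 ⟨hsU, rfl⟩⟩
  refine (card_le_card hsub).trans (card_biUnion_le.trans ?_)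
  simp only [card_powersetCard, le_refl]

/-- Exchange sample points and ghosts at the indices where `σ` is true. -/
def swapEquiv (Z : Type*) {n : ℕ} (σ : Fin n → Bool) : (Fin n → Z × Z) ≃ (Fin n → Z × Z) :=
  Equiv.piCongrRight fun i => if σ i then Equiv.prodComm Z Z else Equiv.refl _

theorem swapEquiv_apply {Z : Type*} {n : ℕ} (σ : Fin n → Bool) (w : Fin n → Z × Z) (i : Fin n) :
    swapEquiv Z σ w i = if σ i then (w i).swap else w i := by
  unfold swapEquiv
  cases h : σ i <;> simp [h]

section Ghost

variable {Z : Type*} [DecidableEq Z]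

/-- The weight of a sample point `w.1` and its ghost `w.2`. -/
def ghostWeight (S : Finset Z) (w : Z × Z) : ℝ :=
  if w.1 ∈ S then 0 else if w.2 ∈ S then 2 else 1

theorem ghostWeight_nonneg (S : Finset Z) (w : Z × Z) : 0 ≤ ghostWeight S w := by
  unfold ghostWeight; split_ifs <;> norm_num

theorem ghostWeight_add_swap_le (S : Finset Z) (w : Z × Z) :
    ghostWeight S w + ghostWeight S w.swap ≤ 2 := by
  unfold ghostWeight
  by_cases h1 : w.1 ∈ S <;> by_cases h2 : w.2 ∈ S <;> (simp [h1, h2]; try norm_num)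

/-- The points of a double sample. -/
def doubleSupport {n : ℕ} (w : Fin n → Z × Z) : Finset Z :=
  univ.biUnion fun i => {(w i).1, (w i).2}

theorem card_doubleSupport_le {n : ℕ} (w : Fin n → Z × Z) : (doubleSupport w).card ≤ 2 * n := by
  refine card_biUnion_le.trans ((sum_le_sum fun i _ => card_le_two).trans ?_)
  simp [mul_comm]

theorem doubleSupport_swapEquiv {n : ℕ} (σ : Fin n → Bool) (w : Fin n → Z × Z) :
    doubleSupport (swapEquiv Z σ w) = doubleSupport w := by
  unfold doubleSupport
  refine biUnion_congr rfl fun i _ => ?_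
  rw [swapEquiv_apply]
  cases σ i
  · simp
  · simp [pair_comm]

variable [Fintype Z]

/-- Exchanging points with their ghosts preserves both the law of the double sample and its support,
hence its traces. Averaged over all `2 ^ n` exchanges, a trace contributes at most 1, because the
weights of a pair and of its swap add up to at most 2. Sauer–Shelah bounds the number of traces. -/
theorem sum_double_ghostWeight_le (p : Z → ℝ) (hp : p ∈ stdSimplex ℝ Z)
    (𝒮 : Finset (Finset Z)) (d n : ℕ) (h : ∀ s, 𝒮.Shatters s → s.card ≤ d) :
    ∑ w : Fin n → Z × Z, (∏ i, p (w i).1 * p (w i).2) *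
        ∑ T ∈ 𝒮.image (· ∩ doubleSupport w), ∏ i, ghostWeight T (w i)
      ≤ (2 * n + 1) ^ d := by
  set q : (Fin n → Z × Z) → ℝ := fun w => ∏ i, p (w i).1 * p (w i).2 with hq
  set Φ : (Fin n → Z × Z) → ℝ :=
    fun w => ∑ T ∈ 𝒮.image (· ∩ doubleSupport w), ∏ i, ghostWeight T (w i) with hΦ
  have hq0 : ∀ w, 0 ≤ q w := fun w => prod_nonneg fun i _ => mul_nonneg (hp.1 _) (hp.1 _)
  have hq1 : ∑ w, q w = 1 := by
    have := Fintype.sum_pow (fun z : Z × Z => p z.1 * p z.2) n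
    rw [hq, ← this, Fintype.sum_prod_type]
    simp [← mul_sum, hp.2]
  have hswap : ∀ σ : Fin n → Bool, ∑ w, q w * Φ w = ∑ w, q w * Φ (swapEquiv Z σ w) := by
    intro σ
    rw [← Equiv.sum_comp (swapEquiv Z σ)]
    refine sum_congr rfl fun w _ => ?_
    congr 1
    refine prod_congr rfl fun i _ => ?_
    rw [swapEquiv_apply]
    cases σ i
    · simp
    · simp [mul_comm]
  have hbound : ∀ w, ∑ σ : Fin n → Bool, Φ (swapEquiv Z σ w) ≤ 2 ^ n * (2 * n + 1) ^ d := by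
    intro w
    have hT : ∀ T : Finset Z,
        ∑ σ : Fin n → Bool, ∏ i, ghostWeight T (swapEquiv Z σ w i) ≤ 2 ^ n := by
      intro T
      simp only [swapEquiv_apply]
      rw [← Fintype.prod_sum fun (i : Fin n) (b : Bool) =>
        ghostWeight T (if b then (w i).swap else w i)]
      calc ∏ i : Fin n, ∑ b : Bool, ghostWeight T (if b then (w i).swap else w i)
          ≤ ∏ _i : Fin n, (2 : ℝ) := by
            refine prod_le_prod (fun i _ => sum_nonneg fun b _ => ghostWeight_nonneg _ _)
              fun i _ => ?_
            rw [Fintype.sum_bool]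
            simpa [add_comm] using ghostWeight_add_swap_le T (w i)
        _ = 2 ^ n := by simp
    simp only [hΦ, doubleSupport_swapEquiv]
    rw [sum_comm]
    refine (sum_le_sum fun T _ => hT T).trans ?_
    rw [sum_const, nsmul_eq_mul, mul_comm]
    refine mul_le_mul_of_nonneg_left ?_ (by positivity)
    have h1 := card_trace_le 𝒮 (doubleSupport w) d h
    have h2 : ((doubleSupport w).card + 1) ^ d ≤ (2 * n + 1) ^ d :=
      Nat.pow_le_pow_left (by have := card_doubleSupport_le w; omega) d
    exact_mod_cast h1.trans h2
  have h2n : (0 : ℝ) < 2 ^ n := by positivity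
  refine le_of_mul_le_mul_left ?_ h2n
  calc 2 ^ n * ∑ w, q w * Φ w = ∑ σ : Fin n → Bool, ∑ w, q w * Φ (swapEquiv Z σ w) := by
        rw [← sum_congr rfl fun σ _ => hswap σ, sum_const, nsmul_eq_mul]
        simp
    _ = ∑ w, q w * ∑ σ : Fin n → Bool, Φ (swapEquiv Z σ w) := by
        rw [sum_comm]; simp only [mul_sum]
    _ ≤ ∑ w, q w * (2 ^ n * (2 * n + 1) ^ d) :=
        sum_le_sum fun w _ => mul_le_mul_of_nonneg_left (hbound w) (hq0 w)
    _ = 2 ^ n * (2 * n + 1) ^ d := by rw [← sum_mul, hq1, one_mul]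

open Classical in
/-- The probability that a sample of size `n` misses a set of the family whose probability is at
least `ε`. -/
theorem missing_probability_mul_le (p : Z → ℝ) (hp : p ∈ stdSimplex ℝ Z)
    (𝒮 : Finset (Finset Z)) (d n : ℕ) (h : ∀ s, 𝒮.Shatters s → s.card ≤ d) {ε : ℝ}
    (hε : 0 ≤ ε) :
    (∑ x : Fin n → Z, if ∃ S ∈ 𝒮, ε ≤ ∑ z ∈ S, p z ∧ ∀ i, x i ∉ S then ∏ i, p (x i) else 0)
      * (1 + ε) ^ n ≤ (2 * n + 1) ^ d := by
  refine le_trans ?_ (sum_double_ghostWeight_le p hp 𝒮 d n h)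
  rw [← Equiv.sum_comp (Equiv.arrowProdEquivProdArrow (Fin n) (fun _ => Z) (fun _ => Z)).symm,
    Fintype.sum_prod_type, sum_mul]
  refine sum_le_sum fun x _ => ?_
  simp only [Equiv.arrowProdEquivProdArrow, Equiv.coe_fn_symm_mk, prod_mul_distrib]
  split_ifs with hx
  · obtain ⟨S, hS, hεS, hxS⟩ := hx
    simp only [mul_assoc]
    rw [← mul_sum]
    refine mul_le_mul_of_nonneg_left ?_ (prod_nonneg fun i _ => hp.1 _)
    -- For a sample missing `S`, independence of the ghosts makes the mean weight equal to (1 +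
    -- p(S))^n. This exponential moment replaces the usual tail bound for the ghost sample.
    have h1 : ∑ z, p z * (if z ∈ S then (2 : ℝ) else 1) = 1 + ∑ z ∈ S, p z := by
      have : ∀ z, p z * (if z ∈ S then (2 : ℝ) else 1) = p z + if z ∈ S then p z else 0 := by
        intro z; split_ifs <;> ring
      simp only [this, sum_add_distrib, hp.2]
      simp
    calc (1 + ε) ^ n ≤ (∑ z, p z * (if z ∈ S then (2 : ℝ) else 1)) ^ n :=
          pow_le_pow_left₀ (by linarith) (by rw [h1]; linarith) n
      _ = ∑ y : Fin n → Z, (∏ i, p (y i)) * ∏ i, (if y i ∈ S then (2 : ℝ) else 1) := by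
          rw [Fintype.sum_pow]; simp only [prod_mul_distrib]
      _ ≤ _ := by
          refine sum_le_sum fun y _ => mul_le_mul_of_nonneg_left ?_
            (prod_nonneg fun i _ => hp.1 _)
          set w : Fin n → Z × Z := fun i => (x i, y i) with hw
          -- The weight sees `S` only through its trace on the double sample, so the missed set is
          -- dominated by one term of the sum over traces.
          have h2 : ∏ i, (if y i ∈ S then (2 : ℝ) else 1)
              = ∏ i, ghostWeight (S ∩ doubleSupport w) (w i) := by
            refine prod_congr rfl fun i _ => ?_
            have hyU : y i ∈ doubleSupport w :=
              mem_biUnion.2 ⟨i, mem_univ _, by simp [hw]⟩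
            simp [ghostWeight, hw, hxS i]
            simp [← hw, hyU]
          rw [h2]
          exact single_le_sum (f := fun T => ∏ i, ghostWeight T (w i))
            (fun T _ => prod_nonneg fun i _ => ghostWeight_nonneg _ _)
            (mem_image_of_mem (· ∩ doubleSupport w) hS)
  · rw [zero_mul]
    exact sum_nonneg fun y _ => mul_nonneg
      (mul_nonneg (prod_nonneg fun i _ => hp.1 _) (prod_nonneg fun i _ => hp.1 _))
      (sum_nonneg fun T _ => prod_nonneg fun i _ => ghostWeight_nonneg _ _)

end Ghost

/-! ### Pseudodimension and the VC dimension of disagreement sets -/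

theorem card_le_pdim {Z : Type*} [Fintype Z] {H : Set (Z → ℝ)} {s : Finset Z}
    (h : PseudoShatters H s) : s.card ≤ (pdim H).toNat := by
  have h1 : (s.card : ℕ∞) ≤ pdim H :=
    le_iSup₂_of_le (f := fun (S : Finset Z) (_ : PseudoShatters H S) => (S.card : ℕ∞)) s h le_rfl
  rw [← ENat.natCast_toNat (pdim_ne_top H)] at h1
  exact_mod_cast h1

open Classical in
/-- The sets `{z | g z < h z}`, `h ∈ H`. -/
noncomputable def upperFamily {Z : Type*} [Fintype Z] (H : Set (Z → ℝ)) (g : Z → ℝ) :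
    Finset (Finset Z) :=
  univ.filter fun S => ∃ h ∈ H, ∀ z, z ∈ S ↔ g z < h z

theorem mem_upperFamily {Z : Type*} [Fintype Z] {H : Set (Z → ℝ)} {g : Z → ℝ} {S : Finset Z} :
    S ∈ upperFamily H g ↔ ∃ h ∈ H, ∀ z, z ∈ S ↔ g z < h z := by
  simp [upperFamily]

open Classical in
/-- The sets `{z | h z < g z}`, `h ∈ H`. -/
noncomputable def lowerFamily {Z : Type*} [Fintype Z] (H : Set (Z → ℝ)) (g : Z → ℝ) :
    Finset (Finset Z) :=
  univ.filter fun S => ∃ h ∈ H, ∀ z, z ∈ S ↔ h z < g z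

theorem mem_lowerFamily {Z : Type*} [Fintype Z] {H : Set (Z → ℝ)} {g : Z → ℝ} {S : Finset Z} :
    S ∈ lowerFamily H g ↔ ∃ h ∈ H, ∀ z, z ∈ S ↔ h z < g z := by
  simp [lowerFamily]

theorem empty_mem_upperFamily {Z : Type*} [Fintype Z] {H : Set (Z → ℝ)} {g : Z → ℝ} (hg : g ∈ H) :
    ∅ ∈ upperFamily H g :=
  mem_upperFamily.2 ⟨g, hg, by simp⟩

theorem empty_mem_lowerFamily {Z : Type*} [Fintype Z] {H : Set (Z → ℝ)} {g : Z → ℝ} (hg : g ∈ H) :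
    ∅ ∈ lowerFamily H g :=
  mem_lowerFamily.2 ⟨g, hg, by simp⟩

theorem exists_pos_forall_lt {ι : Type*} (s : Finset ι) (u : ι → ℝ) (hu : ∀ i ∈ s, 0 < u i) :
    ∃ e > 0, ∀ i ∈ s, e < u i := by
  induction s using Finset.cons_induction with
  | empty => exact ⟨1, one_pos, by simp⟩
  | cons a s ha ih =>
    obtain ⟨e, he, h⟩ := ih fun i hi => hu i (mem_cons_of_mem hi)
    have hua := hu a (mem_cons_self a s)
    refine ⟨min e (u a / 2), lt_min he (by linarith), fun i hi => ?_⟩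
    rcases mem_cons.1 hi with rfl | hi
    · exact (min_le_right _ _).trans_lt (by linarith)
    · exact (min_le_left _ _).trans_lt (h i hi)

section

variable {Z : Type*} [Fintype Z]

/-- Pseudo-shattering asks for strict inequalities on both sides, while `z ∉ T` only gives `h z ≤ g
z`. Raising the witness `g` by less than the smallest of the finitely many positive gaps makes both
strict. -/
theorem card_le_pdim_of_shatters_upperFamily [DecidableEq Z] {H : Set (Z → ℝ)} {g : Z → ℝ} {s : Finset Z}
    (hs : (upperFamily H g).Shatters s) : s.card ≤ (pdim H).toNat := by
  refine card_le_pdim ?_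
  have key : ∀ T : Finset Z, ∃ h : Z → ℝ, T ⊆ s → h ∈ H ∧ ∀ z ∈ s, z ∈ T ↔ g z < h z := by
    intro T
    by_cases hT : T ⊆ s
    · obtain ⟨u, hu, huT⟩ := hs hT
      obtain ⟨h, hh, hu⟩ := mem_upperFamily.1 hu
      refine ⟨h, fun _ => ⟨hh, fun z hz => ?_⟩⟩
      rw [← huT]
      simp [hz, hu]
    · exact ⟨0, fun h => absurd h hT⟩
  choose h hh using key
  obtain ⟨e, he, hlt⟩ := exists_pos_forall_lt (s.powerset.sigma fun T => T)
    (fun i => h i.1 i.2 - g i.2) (by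
      rintro ⟨T, z⟩ hz
      obtain ⟨hT, hz⟩ := mem_sigma.1 hz
      have hT := mem_powerset.1 hT
      exact sub_pos.2 (((hh T hT).2 z (hT hz)).1 hz))
  refine ⟨fun z => g z + e, fun T hT => ⟨h T, (hh T hT).1, fun z hz => ⟨fun hzT => ?_,
    fun hzT => ?_⟩⟩⟩
  · have := hlt ⟨T, z⟩ (mem_sigma.2 ⟨mem_powerset.2 hT, hzT⟩)
    simp only at this
    linarith
  · have : ¬ g z < h T z := fun hc => hzT (((hh T hT).2 z hz).2 hc)
    linarith

theorem card_le_pdim_of_shatters_lowerFamily [DecidableEq Z] {H : Set (Z → ℝ)} {g : Z → ℝ} {s : Finset Z}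
    (hs : (lowerFamily H g).Shatters s) : s.card ≤ (pdim H).toNat := by
  refine card_le_pdim ?_
  have key : ∀ T : Finset Z, ∃ h : Z → ℝ, T ⊆ s → h ∈ H ∧ ∀ z ∈ s, z ∉ T ↔ h z < g z := by
    intro T
    by_cases hT : T ⊆ s
    -- Membership in the lower set means a negative sign, so the pattern `T` is realized by cutting
    -- out `s \ T`; the witness is then lowered instead of raised.
    · obtain ⟨u, hu, huT⟩ := hs (t := s \ T) sdiff_subset
      obtain ⟨h, hh, hu⟩ := mem_lowerFamily.1 hu
      refine ⟨h, fun _ => ⟨hh, fun z hz => ?_⟩⟩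
      have := congrArg (z ∈ ·) huT
      rw [← hu z]
      simpa [hz] using this.symm
    · exact ⟨0, fun h => absurd h hT⟩
  choose h hh using key
  obtain ⟨e, he, hlt⟩ := exists_pos_forall_lt (s.powerset.sigma fun T => s \ T)
    (fun i => g i.2 - h i.1 i.2) (by
      rintro ⟨T, z⟩ hz
      obtain ⟨hT, hz⟩ := mem_sigma.1 hz
      have hT := mem_powerset.1 hT
      obtain ⟨hzs, hzT⟩ := mem_sdiff.1 hz
      exact sub_pos.2 (((hh T hT).2 z hzs).1 hzT))
  refine ⟨fun z => g z - e, fun T hT => ⟨h T, (hh T hT).1, fun z hz => ⟨fun hzT => ?_,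
    fun hzT => ?_⟩⟩⟩
  · have : ¬ h T z < g z := fun hc => ((hh T hT).2 z hz).2 hc hzT
    linarith
  · have := hlt ⟨T, z⟩ (mem_sigma.2 ⟨mem_powerset.2 hT, mem_sdiff.2 ⟨hz, hzT⟩⟩)
    simp only at this
    linarith

/-- With L = Kn/δ ≥ 2, both 2n + 1 and 2(n + 1) are at most L³. The growth function costs L^(3d) and
the failure probability L⁴, and 3d + 4 ≤ 7d because d ≥ 1. -/
theorem growth_mul_exp_le {n K d : ℕ} {δ : ℝ} (hδ : δ ∈ Set.Ioo (0 : ℝ) 1) (hd : 1 ≤ d)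
    (hKn : 2 ≤ K * n) :
    (2 * n + 1 : ℝ) ^ d ≤
      δ / (2 * K * n * (n + 1)) * Real.exp (7 * d * Real.log (K * n / δ)) := by
  obtain ⟨hδ0, hδ1⟩ := hδ
  have hn : 1 ≤ n := Nat.pos_of_ne_zero (by rintro rfl; simp at hKn)
  have hK : 1 ≤ K := Nat.pos_of_ne_zero (by rintro rfl; simp at hKn)
  have hn' : (1 : ℝ) ≤ n := by exact_mod_cast hn
  have hK' : (1 : ℝ) ≤ K := by exact_mod_cast hK
  have hKn' : (2 : ℝ) ≤ K * n := by exact_mod_cast hKn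
  set L : ℝ := K * n / δ with hL
  have hLKn : K * n ≤ L := by
    rw [hL, le_div_iff₀ hδ0]
    nlinarith
  have hL2 : 2 ≤ L := hKn'.trans hLKn
  have hnL : n ≤ L := le_trans (by nlinarith) hLKn
  have hL0 : 0 < L := by linarith
  have h1 : (2 * n + 1 : ℝ) ≤ L ^ 3 := by
    have : 4 ≤ L ^ 2 := by nlinarith
    calc (2 * n + 1 : ℝ) ≤ 4 * L := by linarith
      _ ≤ L ^ 2 * L := by gcongr
      _ = L ^ 3 := by ring
  have h2 : (2 * (n + 1) : ℝ) ≤ L ^ 3 := by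
    have : 4 ≤ L ^ 2 := by nlinarith
    calc (2 * (n + 1) : ℝ) ≤ 4 * L := by linarith
      _ ≤ L ^ 2 * L := by gcongr
      _ = L ^ 3 := by ring
  have h3 : δ / (2 * K * n * (n + 1)) = 1 / (L * (2 * (n + 1))) := by
    rw [hL]; field_simp
  have h4 : Real.exp (7 * d * Real.log L) = L ^ (7 * d) := by
    rw [← Real.log_rpow hL0, Real.exp_log (Real.rpow_pos_of_pos hL0 _)]
    exact_mod_cast Real.rpow_natCast L (7 * d)
  rw [h3, h4, div_mul_eq_mul_div, one_mul, le_div_iff₀ (by positivity)]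
  calc (2 * n + 1 : ℝ) ^ d * (L * (2 * (n + 1))) ≤ (L ^ 3) ^ d * (L * L ^ 3) := by gcongr
    _ = L ^ (3 * d + 4) := by rw [← pow_mul]; ring
    _ ≤ L ^ (7 * d) := pow_le_pow_right₀ (by linarith) (by omega)

open Classical in
theorem missing_probability_le [DecidableEq Z] (p : Z → ℝ) (hp : p ∈ stdSimplex ℝ Z)
    (𝒮 : Finset (Finset Z)) (d n K : ℕ) (h : ∀ s, 𝒮.Shatters s → s.card ≤ d) (h0 : ∅ ∈ 𝒮)
    {δ : ℝ} (hδ : δ ∈ Set.Ioo (0 : ℝ) 1) (hKn : 2 ≤ K * n) :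
    (∑ x : Fin n → Z, if ∃ S ∈ 𝒮, 14 * d * Real.log (K * n / δ) / n < ∑ z ∈ S, p z ∧
      ∀ i, x i ∉ S then ∏ i, p (x i) else 0) ≤ δ / (2 * K * n * (n + 1)) := by
  have hδ0 := hδ.1
  have hn : 1 ≤ n := Nat.pos_of_ne_zero (by rintro rfl; simp at hKn)
  have hn' : (1 : ℝ) ≤ n := by exact_mod_cast hn
  set ε : ℝ := 14 * d * Real.log (K * n / δ) / n with hε
  have htriv : (∀ S ∈ 𝒮, ∑ z ∈ S, p z ≤ ε) →
      (∑ x : Fin n → Z, if ∃ S ∈ 𝒮, ε < ∑ z ∈ S, p z ∧ ∀ i, x i ∉ S then ∏ i, p (x i) else 0)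
        ≤ δ / (2 * K * n * (n + 1)) := by
    intro hS
    rw [sum_eq_zero fun x _ => if_neg ?_]
    · positivity
    · rintro ⟨S, hS', hlt, -⟩
      exact absurd (hS S hS') (not_le.2 hlt)
  -- For `d = 0` the threshold is 0. A nonempty member together with `∅` would shatter a singleton,
  -- so `∅` is the only member and nothing exceeds the threshold.
  rcases Nat.eq_zero_or_pos d with rfl | hd
  · refine htriv fun S hS => ?_
    rcases S.eq_empty_or_nonempty with rfl | ⟨z, hz⟩
    · simp [hε]
    · have : ({z} : Finset Z).card ≤ 0 := by
        refine h _ fun t ht => ?_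
        rcases subset_singleton_iff.1 ht with rfl | rfl
        · exact ⟨∅, h0, by simp⟩
        · exact ⟨S, hS, by simpa using hz⟩
      simp at this
  rcases le_or_gt 1 ε with h1 | h1
  · refine htriv fun S _ => le_trans ?_ h1
    rw [← hp.2]
    exact sum_le_sum_of_subset_of_nonneg (subset_univ S) fun z _ _ => hp.1 z
  have hlog : 0 ≤ Real.log (K * n / δ) := by
    refine Real.log_nonneg ((one_le_div hδ0).2 ?_)
    have : (2 : ℝ) ≤ K * n := by exact_mod_cast hKn
    linarith [hδ.2]
  have hε0 : 0 ≤ ε := by positivity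
  have hexp : Real.exp (7 * d * Real.log (K * n / δ)) ≤ (1 + ε) ^ n := by
    -- This uses ε ≤ 1, and the factor 1/2 lost here is why the threshold has 14 = 2 · 7.
    have h2 : ε / 2 ≤ Real.log (1 + ε) := by
      refine le_trans ?_ (Real.le_log_one_add_of_nonneg hε0)
      rw [div_le_div_iff₀ (by norm_num) (by linarith)]
      nlinarith
    have h3 : 7 * d * Real.log (K * n / δ) = n * (ε / 2) := by
      rw [hε]; field_simp; ring
    rw [h3, ← Real.exp_log (show 0 < 1 + ε by linarith), ← Real.exp_nat_mul]
    exact Real.exp_le_exp.2 (by gcongr)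
  have hmain := missing_probability_mul_le p hp 𝒮 d n h hε0
  refine le_of_mul_le_mul_right ?_ (pow_pos (show 0 < 1 + ε by linarith) n)
  calc _ ≤ _ := mul_le_mul_of_nonneg_right (sum_le_sum fun x _ => ?_)
        (pow_nonneg (show 0 ≤ 1 + ε by linarith) n)
    _ ≤ (2 * n + 1 : ℝ) ^ d := hmain
    _ ≤ _ := growth_mul_exp_le hδ hd hKn
    _ ≤ _ := mul_le_mul_of_nonneg_left hexp (by positivity)
  have hpos : 0 ≤ ∏ i, p (x i) := prod_nonneg fun i _ => hp.1 _
  split_ifs with h2 h3 h3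
  · exact le_rfl
  · obtain ⟨S, hS, hlt, hx⟩ := h2
    exact absurd ⟨S, hS, hlt.le, hx⟩ h3
  · exact hpos
  · exact le_rfl

/-- The sample `x` misses one of the sets `{g < h}`, `{h < g}`, `h ∈ H`, whose probability is
over `ε`. -/
def Misled (H : Set (Z → ℝ)) (g p : Z → ℝ) (ε : ℝ) {n : ℕ} (x : Fin n → Z) : Prop :=
  (∃ S ∈ upperFamily H g, ε < ∑ z ∈ S, p z ∧ ∀ i, x i ∉ S) ∨
    ∃ S ∈ lowerFamily H g, ε < ∑ z ∈ S, p z ∧ ∀ i, x i ∉ S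

open Classical in
theorem sum_misled_le (p : Z → ℝ) (hp : p ∈ stdSimplex ℝ Z) (H : Set (Z → ℝ)) {g : Z → ℝ}
    (hg : g ∈ H) (n K : ℕ) {δ : ℝ} (hδ : δ ∈ Set.Ioo (0 : ℝ) 1) (hKn : 2 ≤ K * n) :
    (∑ x : Fin n → Z, if Misled H g p (14 * (pdim H).toNat * Real.log (K * n / δ) / n) x
      then ∏ i, p (x i) else 0) ≤ δ / (K * n * (n + 1)) := by
  have h1 := missing_probability_le p hp (upperFamily H g) (pdim H).toNat n K
    (fun s hs => card_le_pdim_of_shatters_upperFamily hs) (empty_mem_upperFamily hg) hδ hKn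
  have h2 := missing_probability_le p hp (lowerFamily H g) (pdim H).toNat n K
    (fun s hs => card_le_pdim_of_shatters_lowerFamily hs) (empty_mem_lowerFamily hg) hδ hKn
  have h3 : δ / (K * n * (n + 1)) = δ / (2 * K * n * (n + 1)) + δ / (2 * K * n * (n + 1)) := by
    have hn : (n : ℝ) ≠ 0 := by rintro h; simp [Nat.cast_eq_zero.1 h] at hKn
    have hK : (K : ℝ) ≠ 0 := by rintro h; simp [Nat.cast_eq_zero.1 h] at hKn
    have hn1 : (n + 1 : ℝ) ≠ 0 := by positivity
    field_simp; ring
  rw [h3]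
  refine le_trans ?_ (add_le_add h1 h2)
  rw [← sum_add_distrib]
  refine sum_le_sum fun x _ => ?_
  have hpos : 0 ≤ ∏ i, p (x i) := prod_nonneg fun i _ => hp.1 _
  unfold Misled
  split_ifs with h4 h5 h6 h6 h5 h6 h6
  · linarith
  · linarith
  · linarith
  · exact absurd h4 (not_or.2 ⟨h5, h6⟩)
  all_goals linarith

end

/-- Agreement on the sample means that the sample misses both `{g < h}` and `{h < g}`. Each then has
probability at most `ε`, and the integrand vanishes outside them. -/
theorem sum_abs_sub_le_of_not_misled {Z : Type*} [Fintype Z] {p : Z → ℝ} (hp : p ∈ stdSimplex ℝ Z) {H : Set (Z → ℝ)}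
    {g h : Z → ℝ} (hh : h ∈ H) {ε M : ℝ} (hM : ∀ z, |h z - g z| ≤ M) (hM0 : 0 ≤ M) {n : ℕ}
    {x : Fin n → Z} (hx : ∀ i, h (x i) = g (x i)) (hnot : ¬ Misled H g p ε x) :
    ∑ z, p z * |h z - g z| ≤ M * (2 * ε) := by
  classical
  unfold Misled at hnot
  push Not at hnot
  have h1 : ∑ z ∈ univ.filter (fun z => g z < h z), p z ≤ ε := by
    by_contra hc
    obtain ⟨i, hi⟩ := hnot.1 _ (mem_upperFamily.2 ⟨h, hh, fun z => by simp⟩) (not_le.1 hc)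
    simp [hx i] at hi
  have h2 : ∑ z ∈ univ.filter (fun z => h z < g z), p z ≤ ε := by
    by_contra hc
    obtain ⟨i, hi⟩ := hnot.2 _ (mem_lowerFamily.2 ⟨h, hh, fun z => by simp⟩) (not_le.1 hc)
    simp [hx i] at hi
  rw [sum_filter] at h1 h2
  calc ∑ z, p z * |h z - g z|
      ≤ ∑ z, M * ((if g z < h z then p z else 0) + if h z < g z then p z else 0) := by
        refine sum_le_sum fun z _ => ?_
        have hpz := hp.1 z
        rcases lt_trichotomy (g z) (h z) with hz | hz | hz
        · rw [if_pos hz, if_neg hz.le.not_gt, add_zero, mul_comm]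
          exact mul_le_mul_of_nonneg_right (hM z) hpz
        · simp [hz]
        · rw [if_pos hz, if_neg hz.le.not_gt, zero_add, mul_comm]
          exact mul_le_mul_of_nonneg_right (hM z) hpz
    _ ≤ M * (2 * ε) := by
        rw [← mul_sum, sum_add_distrib]
        exact mul_le_mul_of_nonneg_left (by linarith) hM0

/-! ### Tilted policies and interpolation by minimizers -/

section Policy

variable {X A : Type*} [Fintype A]

theorem tilt_denom_pos {π₀ : X → A → ℝ} (hπ : IsPolicy π₀) (f : X → A → ℝ) (x : X) :
    0 < ∑ b, π₀ x b * Real.exp (f x b) := by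
  have hnn : ∀ b ∈ univ, 0 ≤ π₀ x b * Real.exp (f x b) :=
    fun b _ => mul_nonneg ((hπ x).1 b) (Real.exp_pos _).le
  refine lt_of_le_of_ne (sum_nonneg hnn) fun h => ?_
  have h0 : ∀ b, π₀ x b = 0 := fun b => by
    have := (sum_eq_zero_iff_of_nonneg hnn).1 h.symm b (mem_univ b)
    exact (mul_eq_zero.1 this).resolve_right (Real.exp_pos _).ne'
  have := (hπ x).2
  simp [h0] at this

theorem isPolicy_tilt {π₀ : X → A → ℝ} (hπ : IsPolicy π₀) (f : X → A → ℝ) :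
    IsPolicy (tilt π₀ f) := fun x => by
  have h := tilt_denom_pos hπ f x
  refine ⟨fun a => div_nonneg (mul_nonneg ((hπ x).1 a) (Real.exp_pos _).le) h.le, ?_⟩
  simp only [tilt]
  rw [← sum_div, div_self h.ne']

theorem base_ne_zero_of_tilt_ne_zero {π₀ f : X → A → ℝ} {x : X} {a : A} (h : tilt π₀ f x a ≠ 0) :
    π₀ x a ≠ 0 := by
  rintro h0
  simp [tilt, h0] at h

theorem tilt_zero {π₀ : X → A → ℝ} (hπ : IsPolicy π₀) : tilt π₀ 0 = π₀ := by
  ext x a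
  simp [tilt, (hπ x).2]

/-- If `π_f = π₀`, then `f(x, ·)` is constant on the support of `π₀(x)`. -/
theorem eq_const_of_tilt_eq {π₀ f : X → A → ℝ} (hπ : IsPolicy π₀) (h : π₀ = tilt π₀ f) {x : X}
    {a : A} (ha : π₀ x a ≠ 0) : f x a = Real.log (∑ b, π₀ x b * Real.exp (f x b)) := by
  have hpos := tilt_denom_pos hπ f x
  have h1 : π₀ x a = π₀ x a * Real.exp (f x a) / ∑ b, π₀ x b * Real.exp (f x b) :=
    congrFun (congrFun h x) a
  rw [eq_div_iff hpos.ne'] at h1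
  rw [mul_left_cancel₀ ha h1, Real.log_exp]

theorem log_tilt {π₀ : X → A → ℝ} (hπ : IsPolicy π₀) (f : X → A → ℝ) {x : X} {a : A}
    (ha : π₀ x a ≠ 0) :
    Real.log (tilt π₀ f x a) =
      Real.log (π₀ x a) + f x a - Real.log (∑ b, π₀ x b * Real.exp (f x b)) := by
  unfold tilt
  rw [Real.log_div (mul_ne_zero ha (Real.exp_pos _).ne') (tilt_denom_pos hπ f x).ne',
    Real.log_mul ha (Real.exp_pos _).ne', Real.log_exp]

theorem tilt_ne_zero {π₀ : X → A → ℝ} (hπ : IsPolicy π₀) (f : X → A → ℝ) {x : X} {a : A}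
    (ha : π₀ x a ≠ 0) : tilt π₀ f x a ≠ 0 :=
  div_ne_zero (mul_ne_zero ha (Real.exp_pos _).ne') (tilt_denom_pos hπ f x).ne'

theorem log_tilt_div_tilt {π₀ : X → A → ℝ} (hπ : IsPolicy π₀) (f : X → A → ℝ) {x : X} {a b : A}
    (ha : π₀ x a ≠ 0) (hb : π₀ x b ≠ 0) :
    Real.log (tilt π₀ f x a / tilt π₀ f x b) =
      Real.log (π₀ x a / π₀ x b) + (f x a - f x b) := by
  rw [Real.log_div (tilt_ne_zero hπ f ha) (tilt_ne_zero hπ f hb), log_tilt hπ f ha,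
    log_tilt hπ f hb, Real.log_div ha hb]
  ring

theorem log_tilt_div_base {π₀ : X → A → ℝ} (hπ : IsPolicy π₀) (f : X → A → ℝ) {x : X} {a : A}
    (ha : π₀ x a ≠ 0) :
    Real.log (tilt π₀ f x a / π₀ x a) = f x a - Real.log (∑ b, π₀ x b * Real.exp (f x b)) := by
  rw [Real.log_div (tilt_ne_zero hπ f ha) ha, log_tilt hπ f ha]
  ring

/-- The objective of a round vanishes at `π_f` iff `f` and `γ⁻¹ r` have the same differences on the
data of the round. -/
theorem roundLoss_tilt_eq_zero_iff {π₀ : X → A → ℝ} (hπ : IsPolicy π₀) {γ : ℝ} (hγ : 0 < γ)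
    {l : ℝ → ℝ → ℝ≥0} (hl : ∀ y z, l y z = 0 ↔ y = z) {scheme : Scheme}
    (hs : ∀ γc, scheme = Scheme.rewardCalibration γc → γc = γ) (r fk f : X → A → ℝ) {n : ℕ}
    {d : Fin n → X × A × A} (hd : ∀ i, π₀ (d i).1 (d i).2.1 ≠ 0 ∧ π₀ (d i).1 (d i).2.2 ≠ 0) :
    roundLoss l γ π₀ r (tilt π₀ fk) d (tilt π₀ f) scheme = 0 ↔
      ∀ i, f (d i).1 (d i).2.1 - f (d i).1 (d i).2.2
        = (γ⁻¹ • r) (d i).1 (d i).2.1 - (γ⁻¹ • r) (d i).1 (d i).2.2 := by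
  cases scheme with
  | fixedRegularization =>
    simp only [roundLoss, rdLoss, sum_eq_zero_iff, mem_univ, true_imp_iff, hl]
    refine forall_congr' fun i => ?_
    rw [log_tilt_div_tilt hπ f (hd i).1 (hd i).2]
    simp only [Pi.smul_apply, smul_eq_mul]
    constructor <;> intro h
    · field_simp; linarith
    · field_simp at h; linarith
  | rewardCalibration γc =>
    -- At calibration level `γ` the contribution of `fk` to the reference policy and to the
    -- corrected reward cancels, leaving the same condition as for fixed regularization.
    obtain rfl := hs γc rfl
    simp only [roundLoss, rdLoss, sum_eq_zero_iff, mem_univ, true_imp_iff, hl]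
    refine forall_congr' fun i => ?_
    rw [log_tilt_div_tilt hπ f (hd i).1 (hd i).2, log_tilt_div_tilt hπ fk (hd i).1 (hd i).2,
      log_tilt_div_base hπ fk (hd i).1, log_tilt_div_base hπ fk (hd i).2]
    simp only [Pi.smul_apply, smul_eq_mul]
    constructor <;> intro h
    · field_simp; linarith
    · field_simp at h; linarith

/-- The competitor `tilt π₀ (γ⁻¹ • r)` has loss zero, so every minimizer has loss zero. -/
theorem sub_eq_sub_of_isMinOn {π₀ : X → A → ℝ} (hπ : IsPolicy π₀) {γ : ℝ} (hγ : 0 < γ)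
    {l : ℝ → ℝ → ℝ≥0} (hl : ∀ y z, l y z = 0 ↔ y = z) {scheme : Scheme}
    (hs : ∀ γc, scheme = Scheme.rewardCalibration γc → γc = γ) {F : Set (X → A → ℝ)}
    {r : X → A → ℝ} (hr : γ⁻¹ • r ∈ F) {fk f : X → A → ℝ} {n : ℕ}
    {d : Fin n → X × A × A} (hd : ∀ i, π₀ (d i).1 (d i).2.1 ≠ 0 ∧ π₀ (d i).1 (d i).2.2 ≠ 0)
    (hmin : IsMinOn (fun π => roundLoss l γ π₀ r (tilt π₀ fk) d π scheme)
      (policyClass π₀ F) (tilt π₀ f)) (i : Fin n) :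
    f (d i).1 (d i).2.1 - f (d i).1 (d i).2.2
      = (γ⁻¹ • r) (d i).1 (d i).2.1 - (γ⁻¹ • r) (d i).1 (d i).2.2 := by
  refine (roundLoss_tilt_eq_zero_iff hπ hγ hl hs r fk f hd).1 ?_ i
  have h1 := isMinOn_iff.1 hmin (tilt π₀ (γ⁻¹ • r)) ⟨_, hr, rfl⟩
  rw [(roundLoss_tilt_eq_zero_iff hπ hγ hl hs r fk (γ⁻¹ • r) hd).2 fun i => rfl] at h1
  exact le_antisymm h1 zero_le

end Policy

/-! ### Mean absolute deviation and coverage -/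

section MAD

variable {X A : Type*} [Fintype X] [Fintype A] {D : X → ℝ} {π : X → A → ℝ}

/-- The law of a prompt with two independent responses. -/
noncomputable def pairDist {X A : Type*} (D : X → ℝ) (π : X → A → ℝ) (z : X × A × A) : ℝ :=
  D z.1 * π z.1 z.2.1 * π z.1 z.2.2

theorem pairDist_mem (hD : D ∈ stdSimplex ℝ X) (hπ : IsPolicy π) :
    pairDist D π ∈ stdSimplex ℝ (X × A × A) := by
  refine ⟨fun z => mul_nonneg (mul_nonneg (hD.1 _) ((hπ _).1 _)) ((hπ _).1 _), ?_⟩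
  simp only [Fintype.sum_prod_type, pairDist]
  simp only [← mul_sum, (hπ _).2, mul_one, hD.2]

/-- Jensen in the second response. The right-hand side involves only the pairwise differences that
the data reveal. -/
theorem MAD_le_sum_pairDist (hD : D ∈ stdSimplex ℝ X) (hπ : IsPolicy π) (f : X → A → ℝ) :
    MAD D π f ≤ ∑ z, pairDist D π z * |f z.1 z.2.1 - f z.1 z.2.2| := by
  simp only [Fintype.sum_prod_type, pairDist, MAD]
  refine sum_le_sum fun x _ => ?_
  simp only [mul_assoc]
  simp only [← mul_sum]
  refine mul_le_mul_of_nonneg_left (sum_le_sum fun a _ =>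
    mul_le_mul_of_nonneg_left ?_ ((hπ x).1 a)) (hD.1 x)
  have : f x a - ∑ b, π x b * f x b = ∑ b, π x b * (f x a - f x b) := by
    simp only [mul_sub, sum_sub_distrib, ← sum_mul, (hπ x).2, one_mul]
  rw [this]
  refine (abs_sum_le_sum_abs _ _).trans (sum_le_sum fun b _ => ?_)
  rw [abs_mul, abs_of_nonneg ((hπ x).1 b)]

theorem MAD_nonneg (hD : D ∈ stdSimplex ℝ X) (hπ : IsPolicy π) (f : X → A → ℝ) :
    0 ≤ MAD D π f :=
  sum_nonneg fun x _ => mul_nonneg (hD.1 x)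
    (sum_nonneg fun a _ => mul_nonneg ((hπ x).1 a) (abs_nonneg _))

theorem MAD_add_le (hD : D ∈ stdSimplex ℝ X) (hπ : IsPolicy π) (f g : X → A → ℝ) :
    MAD D π (f + g) ≤ MAD D π f + MAD D π g := by
  unfold MAD
  rw [← sum_add_distrib]
  refine sum_le_sum fun x _ => ?_
  rw [← mul_add, ← sum_add_distrib]
  refine mul_le_mul_of_nonneg_left (sum_le_sum fun a _ => ?_) (hD.1 x)
  rw [← mul_add]
  refine mul_le_mul_of_nonneg_left ?_ ((hπ x).1 a)
  simp only [Pi.add_apply, mul_add, sum_add_distrib]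
  rw [add_sub_add_comm]
  exact abs_add_le _ _

theorem MAD_congr {f g : X → A → ℝ} (hπ : IsPolicy π) (c : X → ℝ)
    (h : ∀ x a, π x a ≠ 0 → f x a = g x a + c x) : MAD D π f = MAD D π g := by
  unfold MAD
  refine sum_congr rfl fun x _ => ?_
  have h1 : ∑ b, π x b * f x b = ∑ b, π x b * g x b + c x := by
    have : ∀ b, π x b * f x b = π x b * g x b + π x b * c x := by
      intro b
      by_cases hb : π x b = 0
      · simp [hb]
      · rw [h x b hb, mul_add]
    simp only [this, sum_add_distrib, ← sum_mul, (hπ x).2, one_mul]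
  congr 1
  refine sum_congr rfl fun a _ => ?_
  by_cases ha : π x a = 0
  · simp [ha]
  · rw [h x a ha, h1, add_sub_add_right_eq_sub]

/-- The mean absolute deviation is at most the standard deviation. -/
theorem MAD_le_of_abs_le (hD : D ∈ stdSimplex ℝ X) (hπ : IsPolicy π) {f : X → A → ℝ} {R : ℝ}
    (hR : 0 < R) (hf : ∀ x a, |f x a| ≤ R) : MAD D π f ≤ R := by
  have key : ∀ x, ∑ a, π x a * |f x a - ∑ b, π x b * f x b| ≤ R := by
    intro x
    set m := ∑ b, π x b * f x b with hm
    -- AM–GM in the form |y| ≤ (R² + y²)/(2R), with variance at most R². The bound `R`, not `2 * R`,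
    -- is what places the initial error in the domain `[0, R]` of `Cbar`.
    have h1 : ∀ a, π x a * |f x a - m| ≤
        (2 * R)⁻¹ * (π x a * R ^ 2 + π x a * (R ^ 2 - 2 * m * f x a + m ^ 2)) := by
      intro a
      have hpa := (hπ x).1 a
      rw [inv_mul_eq_div, le_div_iff₀ (by positivity), ← mul_add, mul_assoc]
      refine mul_le_mul_of_nonneg_left ?_ hpa
      have h2 : f x a ^ 2 ≤ R ^ 2 := sq_le_sq' (abs_le.1 (hf x a)).1 (abs_le.1 (hf x a)).2
      nlinarith [sq_nonneg (|f x a - m| - R), sq_abs (f x a - m)]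
    refine (sum_le_sum fun a _ => h1 a).trans ?_
    rw [← mul_sum, sum_add_distrib, ← sum_mul, (hπ x).2]
    have h3 : ∑ a, π x a * (R ^ 2 - 2 * m * f x a + m ^ 2) = R ^ 2 - m ^ 2 := by
      have : ∀ a, π x a * (R ^ 2 - 2 * m * f x a + m ^ 2)
          = π x a * (R ^ 2 + m ^ 2) - 2 * m * (π x a * f x a) := fun a => by ring
      simp only [this, sum_sub_distrib, ← sum_mul, ← mul_sum, (hπ x).2]
      rw [← hm]; ring
    rw [h3, inv_mul_eq_div, div_le_iff₀ (by positivity)]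
    nlinarith [sq_nonneg m]
  unfold MAD
  calc _ ≤ ∑ x, D x * R := sum_le_sum fun x _ => mul_le_mul_of_nonneg_left (key x) (hD.1 x)
    _ = R := by rw [← sum_mul, hD.2, one_mul]

theorem MAD_sub_le_of_localCoverage_le (hD : D ∈ stdSimplex ℝ X) {π₀ : X → A → ℝ} {F : Set (X → A → ℝ)}
    (hπ : IsPolicy π₀) {fstar : X → A → ℝ} {r C : ℝ} (hC : localCoverage D π₀ F fstar r ≤ (C : EReal))
    {f : X → A → ℝ} (hf : f ∈ F) (hfr : MAD D (tilt π₀ fstar) (f - fstar) ≤ r) :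
    0 ≤ C ∧ ∀ g ∈ F, ∀ h ∈ F, ∀ e, MAD D (tilt π₀ f) (g - h) ≤ e →
      MAD D (tilt π₀ fstar) (g - h) ≤ C * e := by
  have h1 : coverage D F (tilt π₀ f) (tilt π₀ fstar) ≤ (C : EReal) :=
    le_trans (le_iSup₂_of_le
      (f := fun (f : X → A → ℝ) (_ : f ∈ F ∧ MAD D (tilt π₀ fstar) (f - fstar) ≤ r) =>
        coverage D F (tilt π₀ f) (tilt π₀ fstar)) f ⟨hf, hfr⟩ le_rfl) hC
  have h2 : ∀ C', C < C' → ∃ b < C', 0 < b ∧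
      ∀ f' ∈ F, ∀ g ∈ F, MAD D (tilt π₀ fstar) (f' - g) ≤ b * MAD D (tilt π₀ f) (f' - g) := by
    intro C' hC'
    have h3 : coverage D F (tilt π₀ f) (tilt π₀ fstar) < (C' : EReal) :=
      h1.trans_lt (EReal.coe_lt_coe_iff.2 hC')
    unfold coverage at h3
    simp only [iInf_lt_iff] at h3
    obtain ⟨b, hb, hlt⟩ := h3
    exact ⟨b, EReal.coe_lt_coe_iff.1 hlt, hb⟩
  have hC0 : 0 ≤ C := le_of_forall_gt fun C' hC' => by
    obtain ⟨b, hb, hb0, -⟩ := h2 C' hC'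
    exact hb0.trans hb
  refine ⟨hC0, fun g hg h hh e he => le_of_forall_pos_le_add fun t ht => ?_⟩
  -- The infimum defining coverage need not be attained, hence the slack `t / (e + 1)`, which costs
  -- at most `t` after multiplication by `e`.
  have hm := MAD_nonneg hD (isPolicy_tilt hπ f) (g - h)
  have he0 := hm.trans he
  have ht' : 0 < t / (e + 1) := by positivity
  obtain ⟨b, hb, hb0, hle⟩ := h2 (C + t / (e + 1)) (by linarith)
  calc _ ≤ b * MAD D (tilt π₀ f) (g - h) := hle g hg h hh
    _ ≤ (C + t / (e + 1)) * e := mul_le_mul hb.le he hm (by linarith)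
    _ = C * e + t * (e / (e + 1)) := by ring
    _ ≤ C * e + t := by
      have : e / (e + 1) ≤ 1 := (div_le_one (by linarith)).2 (by linarith)
      linarith [mul_le_of_le_one_right ht.le this]

end MAD

/-- The contraction of the error recursion. -/
theorem le_of_error_recursion {R η M ξ e Cmax : ℝ} (hR : 0 < R) (hη : η ∈ Set.Ioo (0 : ℝ) 1)
    (hM : 0 ≤ M) (hξ : 0 ≤ ξ) (he : 0 ≤ e) (hc : ξ * Cmax ≤ 1 / 224 * R)
    (hsmall : 112 * M * ξ + e ≤ R / 2) (r : ℕ → ℝ) (K : ℕ) (h0 : r 0 ≤ R) (hr : ∀ k, 0 ≤ r k)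
    (hstep : ∀ k < K, r k ≤ R →
      r (k + 1) ≤ (M + r k / R * Cmax) * (112 * η * ξ) + e) :
    r K ≤ R * η ^ K + 2 * (112 * M * ξ + e) := by
  obtain ⟨hη0, hη1⟩ := hη
  have hind : ∀ k ≤ K, r k ≤ R ∧ r k ≤ R * η ^ k + 2 * (112 * M * ξ + e) := by
    intro k
    induction k with
    | zero =>
      intro _
      have : 0 ≤ 112 * M * ξ := by positivity
      exact ⟨h0, by rw [pow_zero]; linarith⟩
    | succ k ih =>
      intro hk
      obtain ⟨ih1, ih2⟩ := ih (by omega)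
      have h1 := hstep k (by omega) ih1
      have h2 : (M + r k / R * Cmax) * (112 * η * ξ) + e
          = η * (112 * M * ξ) + 112 * η * (r k / R) * (ξ * Cmax) + e := by ring
      -- The constant 1/224 = 1/(2 · 112) is chosen to make the coefficient of `r k` equal to η/2.
      -- The spare factor 1/2 lets the additive errors sum to twice their size and keeps the
      -- iterates below `R`.
      have h3 : 112 * η * (r k / R) * (ξ * Cmax) ≤ η / 2 * r k := by
        have : 0 ≤ 112 * η * (r k / R) := by have := hr k; positivity
        calc _ ≤ 112 * η * (r k / R) * (1 / 224 * R) := mul_le_mul_of_nonneg_left hc this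
          _ = η / 2 * r k := by field_simp; ring
      have h4 : η * (112 * M * ξ) ≤ 112 * M * ξ :=
        mul_le_of_le_one_left (by positivity) hη1.le
      have h5 : r (k + 1) ≤ η / 2 * r k + (112 * M * ξ + e) := by linarith
      have h6 : 0 ≤ 112 * M * ξ := by positivity
      refine ⟨by nlinarith [hr k], ?_⟩
      have h7 : η / 2 * r k ≤ η / 2 * (R * η ^ k + 2 * (112 * M * ξ + e)) :=
        mul_le_mul_of_nonneg_left ih2 (by linarith)
      have h8 : 0 ≤ R * η ^ (k + 1) := by positivity
      have h9 : η / 2 * (R * η ^ k + 2 * (112 * M * ξ + e))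
          = R * η ^ (k + 1) / 2 + η * (112 * M * ξ + e) := by ring
      nlinarith
  exact (hind K le_rfl).2

/-! ### From conditional to unconditional probabilities -/

section Conditional

variable {Ω T : Type*} [Fintype T] {m mΩ : MeasurableSpace Ω} {μ : Measure Ω}
  [IsProbabilityMeasure μ]

open Classical in
/-- A bound on the conditional probability that a discrete random variable `Y` lies in a random set
known beforehand gives a bound on the probability. -/
theorem measure_le_of_condExp (hm : m ≤ mΩ) {Y : Ω → T} (hY : ∀ t, MeasurableSet {ω | Y ω = t})
    {q : Ω → T → ℝ}
    (hq : ∀ t, μ[({ω | Y ω = t}).indicator (fun _ => (1 : ℝ)) | m] =ᵐ[μ] fun ω => q ω t)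
    {P : Ω → T → Prop} (hP : ∀ t, MeasurableSet[m] {ω | P ω t}) {β : ℝ}
    (hβ : ∀ ω, (∑ t, if P ω t then q ω t else 0) ≤ β) :
    μ {ω | P ω (Y ω)} ≤ ENNReal.ofReal β := by
  have hint : ∀ t, Integrable (fun ω => q ω t) μ := fun t =>
    (integrable_congr (hq t)).1 integrable_condExp
  have hterm : ∀ t, μ.real ({ω | P ω t} ∩ {ω | Y ω = t}) = ∫ ω, if P ω t then q ω t else 0 ∂μ := by
    -- For fixed `t` the event `P · t` belongs to `m`, so integrating over it replaces the indicator
    -- of `Y = t` by its conditional probability.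
    intro t
    have h1 : ∫ ω, (if P ω t then q ω t else 0) ∂μ = ∫ ω in {ω | P ω t}, q ω t ∂μ := by
      rw [← integral_indicator (hm _ (hP t))]
      rfl
    rw [h1, ← setIntegral_congr_ae (hm _ (hP t)) ((hq t).mono fun ω hω _ => hω),
      setIntegral_condExp hm ((integrable_const (1 : ℝ)).indicator (hY t)) (hP t),
      setIntegral_indicator (hY t)]
    simp
  have hsub : {ω | P ω (Y ω)} ⊆ ⋃ t, {ω | P ω t} ∩ {ω | Y ω = t} := fun ω hω =>
    Set.mem_iUnion.2 ⟨Y ω, hω, rfl⟩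
  have hreal : ∑ t, μ.real ({ω | P ω t} ∩ {ω | Y ω = t}) ≤ β := by
    simp only [hterm]
    rw [← integral_finsetSum]
    · calc _ ≤ ∫ _, β ∂μ := integral_mono (integrable_finsetSum _ fun t _ => (hint t).indicator (hm _ (hP t))) (integrable_const β) hβ
        _ = β := by simp
    · intro t _
      exact (hint t).indicator (hm _ (hP t))
  calc μ {ω | P ω (Y ω)} ≤ ∑ t, μ ({ω | P ω t} ∩ {ω | Y ω = t}) :=
        (measure_mono hsub).trans (measure_iUnion_fintype_le _ _)
    _ = ENNReal.ofReal (∑ t, μ.real ({ω | P ω t} ∩ {ω | Y ω = t})) := by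
        rw [ENNReal.ofReal_sum_of_nonneg fun _ _ => measureReal_nonneg]
        simp
    _ ≤ ENNReal.ofReal β := ENNReal.ofReal_le_ofReal hreal

end Conditional

theorem sum_range_div_mul_succ_le {δ : ℝ} (hδ : 0 ≤ δ) (m : ℕ) :
    ∑ n ∈ range m, δ / (n * (n + 1)) ≤ δ := by
  -- The sum telescopes; the term `n = 0` is `δ / 0 = 0`.
  have h : ∀ m : ℕ, ∑ n ∈ range (m + 1), δ / (n * (n + 1)) = δ * (1 - 1 / (m + 1)) := by
    intro m
    induction m with
    | zero => simp
    | succ m ih =>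
      rw [sum_range_succ, ih]
      push_cast
      field_simp
      ring
  cases m with
  | zero => simpa using hδ
  | succ m =>
    rw [h]
    exact mul_le_of_le_one_right hδ (by have : (0 : ℝ) ≤ 1 / (m + 1) := by positivity
                                        linarith)

/-! ### One round of a run -/

section Run

theorem measurable_pairDist_tilt {X A : Type*} [Fintype A] (D : X → ℝ) (π₀ : X → A → ℝ) (z : X × A × A) :
    Measurable fun f : X → A → ℝ => pairDist D (tilt π₀ f) z := by
  unfold pairDist tilt
  fun_prop

variable {X A : Type*} [Fintype X] [Fintype A]

/-- For a fixed dataset, being misled depends on the past only through the current policy. This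
makes the event known before the round, as conditioning requires. -/
theorem measurableSet_misled (D : X → ℝ) (π₀ : X → A → ℝ) (H : Set (X × A × A → ℝ))
    (g : X × A × A → ℝ) (ε : ℝ) {n : ℕ} (d : Fin n → X × A × A) :
    MeasurableSet {f : X → A → ℝ | Misled H g (pairDist D (tilt π₀ f)) ε d} := by
  have key : ∀ 𝒮 : Finset (Finset (X × A × A)), MeasurableSet {f : X → A → ℝ |
      ∃ S ∈ 𝒮, ε < ∑ z ∈ S, pairDist D (tilt π₀ f) z ∧ ∀ i, d i ∉ S} := by
    intro 𝒮
    have : {f : X → A → ℝ | ∃ S ∈ 𝒮, ε < ∑ z ∈ S, pairDist D (tilt π₀ f) z ∧ ∀ i, d i ∉ S}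
        = ⋃ S ∈ 𝒮, {f | ε < ∑ z ∈ S, pairDist D (tilt π₀ f) z} ∩ {_f | ∀ i, d i ∉ S} := by
      ext f
      simp [and_left_comm]
    rw [this]
    refine 𝒮.measurableSet_biUnion fun S _ => ?_
    exact (measurableSet_lt measurable_const
      (Finset.measurable_sum _ fun z _ => measurable_pairDist_tilt D π₀ z)).inter
        (MeasurableSet.const _)
  exact (key _).union (key _)

variable {Ω : Type*} {mΩ : MeasurableSpace Ω} {μ : Measure Ω} [IsProbabilityMeasure μ]
  {D : X → ℝ} {π₀ : X → A → ℝ} {F : Set (X → A → ℝ)} {rtilde : X → A → ℝ} {γ : ℝ}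
  {l : ℝ → ℝ → ℝ≥0} {scheme : Scheme} {K n : ℕ} {𝒢 : Filtration ℕ mΩ}
  {data : ℕ → Ω → Fin n → X × A × A} {fhat : ℕ → Ω → X → A → ℝ}

/-- The data of a round lie in the support of the base policy. -/
theorem IsRun.ae_data_mem_support (hrun : IsRun μ D π₀ F rtilde γ l scheme K n 𝒢 data fhat)
    {k : ℕ} (hk : k < K) :
    ∀ᵐ ω ∂μ, ∀ i, π₀ (data k ω i).1 (data k ω i).2.1 ≠ 0 ∧
      π₀ (data k ω i).1 (data k ω i).2.2 ≠ 0 := by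
  classical
  have h := measure_le_of_condExp (𝒢.le k) (β := 0)
    (fun d => 𝒢.le (k + 1) _ (hrun.measurable_data k hk d)) (hrun.on_policy k hk)
    (P := fun _ d => ¬ ∀ i, π₀ (d i).1 (d i).2.1 ≠ 0 ∧ π₀ (d i).1 (d i).2.2 ≠ 0)
    (fun d => MeasurableSet.const _) (fun ω => by
      refine (sum_eq_zero fun d _ => ?_).le
      split_ifs with hd
      · rfl
      · push Not at hd
        obtain ⟨i, hi⟩ := hd
        refine prod_eq_zero (mem_univ i) ?_
        by_contra hne
        exact base_ne_zero_of_tilt_ne_zero (right_ne_zero_of_mul hne)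
          (hi (base_ne_zero_of_tilt_ne_zero
            (right_ne_zero_of_mul (left_ne_zero_of_mul hne)))))
  rw [ENNReal.ofReal_zero] at h
  exact ae_iff.2 (le_antisymm h zero_le)

/-- The difference `Δf` of `f` between two responses. -/
def pairDiff {X A : Type*} (f : X → A → ℝ) (z : X × A × A) : ℝ :=
  f z.1 z.2.1 - f z.1 z.2.2

theorem IsRun.measure_misled_le (hrun : IsRun μ D π₀ F rtilde γ l scheme K n 𝒢 data fhat)
    (hD : D ∈ stdSimplex ℝ X) (hπ : IsPolicy π₀) {f : X → A → ℝ} (hf : f ∈ F)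
    {δ : ℝ} (hδ : δ ∈ Set.Ioo (0 : ℝ) 1) (hKn : 2 ≤ K * n) {k : ℕ} (hk : k < K) :
    μ {ω | Misled (deltaClass F) (pairDiff f) (pairDist D (tilt π₀ (fhat k ω)))
      (14 * (pdim (deltaClass F)).toNat * Real.log (K * n / δ) / n) (data k ω)}
      ≤ ENNReal.ofReal (δ / (K * n * (n + 1))) := by
  classical
  exact measure_le_of_condExp (𝒢.le k)
    (fun d => 𝒢.le (k + 1) _ (hrun.measurable_data k hk d)) (hrun.on_policy k hk)
    (P := fun ω d => Misled (deltaClass F) (pairDiff f) (pairDist D (tilt π₀ (fhat k ω)))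
      (14 * (pdim (deltaClass F)).toNat * Real.log (K * n / δ) / n) d)
    (fun d => hrun.measurable_fhat k hk.le (measurableSet_misled D π₀ _ _ _ d))
    (fun ω => sum_misled_le _ (pairDist_mem hD (isPolicy_tilt hπ _)) _
      (show pairDiff f ∈ deltaClass F from ⟨f, hf, rfl⟩) n K hδ hKn)

/-- The constant is 112 = 4 · 2 · 14: differences of two pairwise differences are at most `4 * R`,
there are two disagreement sets, and 14 is the constant of the threshold. The factor `η` undoes the
`1 / η` in `rate`. -/
theorem IsRun.ae_MAD_le (hrun : IsRun μ D π₀ F rtilde γ l scheme K n 𝒢 data fhat)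
    (hD : D ∈ stdSimplex ℝ X) (hπ : IsPolicy π₀) (hγ : 0 < γ) {R : ℝ} (hR : 0 < R)
    (hF : ∀ f ∈ F, ∀ x a, |f x a| ≤ R) (hr : γ⁻¹ • rtilde ∈ F)
    (hl : ∀ y z, l y z = 0 ↔ y = z)
    (hs : ∀ γc, scheme = Scheme.rewardCalibration γc → γc = γ) {η δ : ℝ} (hη : 0 < η)
    {k : ℕ} (hk : k < K) :
    ∀ᵐ ω ∂μ, ¬ Misled (deltaClass F) (pairDiff (γ⁻¹ • rtilde))
      (pairDist D (tilt π₀ (fhat k ω)))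
      (14 * (pdim (deltaClass F)).toNat * Real.log (K * n / δ) / n) (data k ω) →
      MAD D (tilt π₀ (fhat k ω)) (fhat (k + 1) ω - γ⁻¹ • rtilde)
        ≤ 112 * η * rate F R η δ K n := by
  filter_upwards [hrun.ae_data_mem_support hk, hrun.mem_class k hk, hrun.update k hk]
    with ω hsupp hmem hmin hnot
  have hdiff := sub_eq_sub_of_isMinOn hπ hγ hl hs hr hsupp hmin
  have hbound : ∀ z, |pairDiff (fhat (k + 1) ω) z - pairDiff (γ⁻¹ • rtilde) z| ≤ 4 * R := by
    intro z
    have h1 := abs_le.1 (hF _ hmem z.1 z.2.1)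
    have h2 := abs_le.1 (hF _ hmem z.1 z.2.2)
    have h3 := abs_le.1 (hF _ hr z.1 z.2.1)
    have h4 := abs_le.1 (hF _ hr z.1 z.2.2)
    unfold pairDiff
    rw [abs_le]
    constructor <;> linarith
  have h := sum_abs_sub_le_of_not_misled (pairDist_mem hD (isPolicy_tilt hπ _))
    (show pairDiff (fhat (k + 1) ω) ∈ deltaClass F from ⟨_, hmem, rfl⟩) hbound (by linarith)
    hdiff hnot
  refine (MAD_le_sum_pairDist hD (isPolicy_tilt hπ _) _).trans (le_trans (le_of_eq ?_)
    (h.trans (le_of_eq ?_)))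
  · refine sum_congr rfl fun z _ => ?_
    unfold pairDiff
    simp only [Pi.sub_apply]
    congr 2
    ring
  · unfold rate
    field_simp
    ring

end Run

/-- The error bound for a realization of a run whose rounds all generalize. -/
theorem MAD_final_le {X A : Type*} [Fintype X] [Fintype A] {D : X → ℝ} (hD : D ∈ stdSimplex ℝ X)
    {π₀ : X → A → ℝ} (hπ : IsPolicy π₀) {R : ℝ} (hR : 0 < R) {F : Set (X → A → ℝ)}
    (hF : ∀ f ∈ F, ∀ x a, |f x a| ≤ R) (h0 : π₀ ∈ policyClass π₀ F) {fstar : X → A → ℝ}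
    (hfstar : fstar ∈ F) {ftilde : X → A → ℝ} (hftilde : ftilde ∈ F) {Cbar : ℝ → ℝ}
    (hconv : ConvexOn ℝ (Set.Icc 0 R) Cbar) {M : ℝ} (hM : 1 ≤ M) (hCM : Cbar 0 ≤ M)
    (hcov : ∀ r ∈ Set.Icc 0 R, localCoverage D π₀ F fstar r ≤ (Cbar r : EReal))
    {η ξ : ℝ} (hη : η ∈ Set.Ioo (0 : ℝ) 1) (hξ : 0 ≤ ξ) (hc : ξ * Cbar R ≤ 1 / 224 * R)
    {K : ℕ} (hK : 0 < K) (f : ℕ → X → A → ℝ) (hf0 : f 0 = 0) (hf : ∀ k < K, f (k + 1) ∈ F)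
    (hgen : ∀ k < K, MAD D (tilt π₀ (f k)) (f (k + 1) - ftilde) ≤ 112 * η * ξ) :
    MAD D (tilt π₀ fstar) (f K - fstar) ≤
      (896 * M + 8) * max (max ξ (R * η ^ K)) (MAD D (tilt π₀ fstar) (ftilde - fstar)) := by
  have hπs := isPolicy_tilt hπ fstar
  set e := MAD D (tilt π₀ fstar) (ftilde - fstar) with he
  have he0 : 0 ≤ e := MAD_nonneg hD hπs _
  set V := max (max ξ (R * η ^ K)) e with hV
  have hV1 : ξ ≤ V := (le_max_left _ _).trans (le_max_left _ _)
  have hV2 : R * η ^ K ≤ V := (le_max_right _ _).trans (le_max_left _ _)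
  have hV3 : e ≤ V := le_max_right _ _
  have hV0 : 0 ≤ V := hξ.trans hV1
  have hMV : M * ξ ≤ M * V := mul_le_mul_of_nonneg_left hV1 (by linarith)
  have hMV0 : 0 ≤ M * V := by positivity
  -- If this fails, the claim is trivial: the error is at most 2R < 4(112Mξ + e) ≤ (448M + 4)V.
  by_cases hsmall : 112 * M * ξ + e ≤ R / 2
  · have hrec := le_of_error_recursion hR hη (by linarith : 0 ≤ M) hξ he0 hc hsmall
      (fun k => MAD D (tilt π₀ fstar) (f k - fstar)) K ?_ (fun k => MAD_nonneg hD hπs _) ?_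
    · nlinarith
    · refine MAD_le_of_abs_le hD hπs hR fun x a => ?_
      simpa [hf0] using hF _ hfstar x a
    · intro k hk hrk
      set r := MAD D (tilt π₀ fstar) (f k - fstar) with hr
      have hr0 : 0 ≤ r := MAD_nonneg hD hπs _
      -- Coverage is defined for members of `F`, and `f 0 = 0` need not be one. It is replaced by a
      -- `g ∈ F` inducing `π₀`, which on the support depends on the prompt only and so leaves the
      -- MAD unchanged.
      obtain ⟨g, hg, htilt, hgr⟩ : ∃ g ∈ F, tilt π₀ g = tilt π₀ (f k) ∧
          MAD D (tilt π₀ fstar) (g - fstar) ≤ r := by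
        rcases Nat.eq_zero_or_pos k with rfl | hk0
        · obtain ⟨g, hg, hg0⟩ := h0
          refine ⟨g, hg, by rw [hf0, tilt_zero hπ, ← hg0], le_of_eq ?_⟩
          refine MAD_congr hπs (fun x => Real.log (∑ b, π₀ x b * Real.exp (g x b)))
            fun x a hxa => ?_
          have := eq_const_of_tilt_eq hπ hg0 (base_ne_zero_of_tilt_ne_zero hxa)
          simp only [Pi.sub_apply, hf0, Pi.zero_apply]
          rw [this]; ring
        · obtain ⟨j, rfl⟩ := Nat.exists_eq_succ_of_ne_zero hk0.ne'
          exact ⟨_, hf j (by omega), rfl, le_rfl⟩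
      obtain ⟨hC0, hstep⟩ := MAD_sub_le_of_localCoverage_le hD hπ (hcov r ⟨hr0, hrk⟩) hg hgr
      have h1 := hstep _ (hf k hk) _ hftilde (112 * η * ξ) (by rw [htilt]; exact hgen k hk)
      have h2 : MAD D (tilt π₀ fstar) (f (k + 1) - fstar) ≤
          MAD D (tilt π₀ fstar) (f (k + 1) - ftilde) + e := by
        have := MAD_add_le hD hπs (f (k + 1) - ftilde) (ftilde - fstar)
        rwa [sub_add_sub_cancel] at this
      -- The convex function lies below its chord over `[0, R]`.
      have h3 : Cbar r ≤ M + r / R * Cbar R := by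
        have hrR : r / R ≤ 1 := (div_le_one hR).2 hrk
        have hrR0 : 0 ≤ r / R := by positivity
        have := hconv.2 (Set.left_mem_Icc.2 hR.le) (Set.right_mem_Icc.2 hR.le)
          (sub_nonneg.2 hrR) hrR0 (sub_add_cancel 1 (r / R))
        simp only [smul_eq_mul, mul_zero, zero_add, div_mul_cancel₀ r hR.ne'] at this
        nlinarith
      have h4 : 0 ≤ 112 * η * ξ := by have := hη.1; positivity
      linarith [mul_le_mul_of_nonneg_right h3 h4]
  · have hfK : f K ∈ F := by
      obtain ⟨j, rfl⟩ := Nat.exists_eq_succ_of_ne_zero hK.ne'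
      exact hf j (by omega)
    have h1 : MAD D (tilt π₀ fstar) (f K - fstar) ≤ 2 * R := by
      refine MAD_le_of_abs_le hD hπs (by linarith) fun x a => ?_
      have := abs_sub (f K x a) (fstar x a)
      simp only [Pi.sub_apply]
      linarith [hF _ hfK x a, hF _ hfstar x a]
    push Not at hsmall
    nlinarith

theorem rate_nonneg {X A : Type*} (F : Set (X → A → ℝ)) {R η δ : ℝ}
    (hR : 0 ≤ R) (hη : 0 < η) (hδ : δ ∈ Set.Ioo (0 : ℝ) 1) {K n : ℕ} (hKn : 2 ≤ K * n) :
    0 ≤ rate F R η δ K n := by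
  unfold rate
  refine mul_nonneg (by positivity) (Real.log_nonneg ((one_le_div hδ.1).2 ?_))
  have : (2 : ℝ) ≤ K * n := by exact_mod_cast hKn
  linarith [hδ.2]

end RewardDistillation

/-! ### The union bound over rounds and batch sizes -/

theorem mainTheorem4 (B : ℝ) :
    ∃ c > (0 : ℝ), ∃ C > (0 : ℝ),
    ∀ (X A : Type*) [Fintype X] [Fintype A]
      -- prompt distribution, base policy, regularisation parameter, true reward
      (D : X → ℝ) (_ : D ∈ stdSimplex ℝ X)
      (π₀ : X → A → ℝ) (_ : RewardDistillation.IsPolicy π₀)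
      (γ : ℝ) (_ : 0 < γ) (rstar : X → A → ℝ)
      -- bounded function class whose policy class contains the initial policy
      (R : ℝ) (_ : 0 < R) (F : Set (X → A → ℝ)) (_ : ∀ f ∈ F, ∀ x a, |f x a| ≤ R)
      (_ : π₀ ∈ RewardDistillation.policyClass π₀ F)
      -- realizability of the target policy and of the reward model
      (πstar : X → A → ℝ) (_ : πstar = RewardDistillation.tilt π₀ (γ⁻¹ • rstar))
      (fstar : X → A → ℝ) (_ : fstar ∈ F) (_ : πstar = RewardDistillation.tilt π₀ fstar)
      (rtilde : X → A → ℝ) (_ : γ⁻¹ • rtilde ∈ F)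
      -- convex upper bound of the local coverage
      (Cbar : ℝ → ℝ) (_ : ConvexOn ℝ (Set.Icc 0 R) Cbar) (_ : Cbar 0 ≤ B)
      (_ : ∀ r ∈ Set.Icc 0 R, RewardDistillation.localCoverage D π₀ F fstar r ≤ (Cbar r : EReal))
      -- loss function and update scheme
      (l : ℝ → ℝ → ℝ≥0) (_ : ∀ y z, l y z = 0 ↔ y = z)
      (scheme : RewardDistillation.Scheme)
      (_ : ∀ γc, scheme = RewardDistillation.Scheme.rewardCalibration γc → γc = γ)
      (η δ : ℝ) (_ : η ∈ Set.Ioo (0 : ℝ) 1) (_ : δ ∈ Set.Ioo (0 : ℝ) 1) (K : ℕ)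
      -- runs with batch sizes `n ∈ N` on one probability space
      (Ω : Type*) [mΩ : MeasurableSpace Ω] (μ : Measure Ω) [IsProbabilityMeasure μ]
      (N : Set ℕ) (𝒢 : ℕ → Filtration ℕ mΩ)
      (data : (n : ℕ) → ℕ → Ω → Fin n → X × A × A) (fhat : ℕ → ℕ → Ω → X → A → ℝ)
      (_ : ∀ n ∈ N, RewardDistillation.IsRun μ D π₀ F rtilde γ l scheme K n (𝒢 n)
        (data n) (fhat n)),
      ENNReal.ofReal (1 - δ) ≤ μ {ω | ∀ n ∈ N, 2 ≤ K * n →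
        RewardDistillation.rate F R η δ K n * Cbar R ≤ c * R →
        RewardDistillation.MAD D πstar (fhat n K ω - fstar) ≤
          C * max (max (RewardDistillation.rate F R η δ K n) (R * η ^ K))
            (RewardDistillation.MAD D πstar (γ⁻¹ • rtilde - fstar))} := by
  refine ⟨1 / 224, by norm_num, 896 * max B 1 + 8, by positivity, ?_⟩
  intro X A _ _ D hD π₀ hπ γ hγ rstar R hR F hF h0 πstar _ fstar hfstar hπstar rtilde hr Cbar
    hconv hB hcov l hl scheme hs η δ hη hδ K Ω mΩ μ _ N 𝒢 data fhat hrun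
  subst hπstar
  set bad : ℕ → Set Ω := fun n => {ω | n ∈ N ∧ 2 ≤ K * n ∧ ∃ k < K,
    RewardDistillation.Misled (RewardDistillation.deltaClass F)
      (RewardDistillation.pairDiff (γ⁻¹ • rtilde))
      (RewardDistillation.pairDist D (RewardDistillation.tilt π₀ (fhat n k ω)))
      (14 * (RewardDistillation.pdim (RewardDistillation.deltaClass F)).toNat *
        Real.log (K * n / δ) / n) (data n k ω)} with hbad
  have hbad_le : ∀ n, μ (bad n) ≤ ENNReal.ofReal (δ / (n * (n + 1))) := by
    intro n
    by_cases hn : n ∈ N ∧ 2 ≤ K * n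
    · have hK : (K : ℝ) ≠ 0 := by rintro h; simp [Nat.cast_eq_zero.1 h] at hn
      refine (measure_mono (t := ⋃ k ∈ range K, {ω |
        RewardDistillation.Misled (RewardDistillation.deltaClass F)
          (RewardDistillation.pairDiff (γ⁻¹ • rtilde))
          (RewardDistillation.pairDist D (RewardDistillation.tilt π₀ (fhat n k ω)))
          (14 * (RewardDistillation.pdim (RewardDistillation.deltaClass F)).toNat *
            Real.log (K * n / δ) / n) (data n k ω)}) ?_).trans
        ((measure_biUnion_finset_le _ _).trans ((sum_le_sum fun k hk =>
          (hrun n hn.1).measure_misled_le hD hπ hr hδ hn.2 (mem_range.1 hk)).trans ?_))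
      · rintro ω ⟨-, -, k, hk, hω⟩
        exact Set.mem_biUnion (mem_coe.2 (mem_range.2 hk)) hω
      · rw [sum_const, card_range, nsmul_eq_mul, ← ENNReal.ofReal_natCast,
          ← ENNReal.ofReal_mul (Nat.cast_nonneg K)]
        refine ENNReal.ofReal_le_ofReal (le_of_eq ?_)
        rw [mul_assoc, mul_div_assoc', mul_div_mul_left _ _ hK]
    · rw [show bad n = ∅ from Set.eq_empty_of_forall_notMem fun ω hω => hn ⟨hω.1, hω.2.1⟩,
        measure_empty]
      exact zero_le
  have hunion : μ (⋃ n, bad n) ≤ ENNReal.ofReal δ := by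
    refine (measure_iUnion_le _).trans (ENNReal.tsum_le_of_sum_range_le fun m => ?_)
    refine (sum_le_sum fun n _ => hbad_le n).trans ?_
    rw [← ENNReal.ofReal_sum_of_nonneg fun n _ => by have := hδ.1; positivity]
    exact ENNReal.ofReal_le_ofReal (RewardDistillation.sum_range_div_mul_succ_le hδ.1.le m)
  have hae : ∀ᵐ ω ∂μ, ∀ n ∈ N, ∀ k < K, fhat n (k + 1) ω ∈ F ∧
      (¬ RewardDistillation.Misled (RewardDistillation.deltaClass F)
        (RewardDistillation.pairDiff (γ⁻¹ • rtilde))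
        (RewardDistillation.pairDist D (RewardDistillation.tilt π₀ (fhat n k ω)))
        (14 * (RewardDistillation.pdim (RewardDistillation.deltaClass F)).toNat *
          Real.log (K * n / δ) / n) (data n k ω) →
        RewardDistillation.MAD D (RewardDistillation.tilt π₀ (fhat n k ω))
          (fhat n (k + 1) ω - γ⁻¹ • rtilde) ≤
          112 * η * RewardDistillation.rate F R η δ K n) := by
    simp only [ae_all_iff]
    intro n hn k hk
    filter_upwards [(hrun n hn).mem_class k hk,
      (hrun n hn).ae_MAD_le hD hπ hγ hR hF hr hl hs hη.1 hk] with ω h1 h2 using ⟨h1, h2⟩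
  set good : Set Ω := {ω | ∀ n ∈ N, 2 ≤ K * n →
    RewardDistillation.rate F R η δ K n * Cbar R ≤ 1 / 224 * R →
    RewardDistillation.MAD D (RewardDistillation.tilt π₀ fstar) (fhat n K ω - fstar) ≤
      (896 * max B 1 + 8) * max (max (RewardDistillation.rate F R η δ K n) (R * η ^ K))
        (RewardDistillation.MAD D (RewardDistillation.tilt π₀ fstar) (γ⁻¹ • rtilde - fstar))}
    with hgood
  -- Covering the space and using subadditivity avoids taking complements, so measurability of
  -- `good` is not needed.
  have hcover : (Set.univ : Set Ω) ≤ᵐ[μ] ((⋃ n, bad n) ∪ good : Set Ω) := by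
    filter_upwards [hae] with ω hω _
    by_cases hωbad : ω ∈ ⋃ n, bad n
    · exact Or.inl hωbad
    refine Or.inr fun n hn hKn hc => ?_
    exact RewardDistillation.MAD_final_le hD hπ hR hF h0 hfstar hr hconv (le_max_right B 1)
      (hB.trans (le_max_left B 1)) hcov hη
      (RewardDistillation.rate_nonneg F hR.le hη.1 hδ hKn) hc
      (Nat.pos_of_ne_zero (by rintro rfl; simp at hKn)) (fun k => fhat n k ω)
      ((hrun n hn).init ω) (fun k hk => (hω n hn k hk).1)
      fun k hk => (hω n hn k hk).2 fun hmis =>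
        hωbad (Set.mem_iUnion.2 ⟨n, hn, hKn, k, hk, hmis⟩)
  have htotal : 1 ≤ ENNReal.ofReal δ + μ good := by
    calc (1 : ℝ≥0∞) = μ Set.univ := measure_univ.symm
      _ ≤ μ ((⋃ n, bad n) ∪ good) := measure_mono_ae hcover
      _ ≤ μ (⋃ n, bad n) + μ good := measure_union_le _ _
      _ ≤ _ := by gcongr
  rw [ENNReal.ofReal_sub 1 hδ.1.le, ENNReal.ofReal_one]
  exact tsub_le_iff_left.2 htotal
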